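/- Let $m,n\ge 1$ be integers with $m(n-1)$ even, let $\mathbf h=(h_0,h_1,\dots,h_{m(n-1)})\in\mathbb R^{m(n-1)+1}$, and let $\mathcal H$ be the $m$-th order $n$-dimensional Hankel tensor generated by $\mathbf h$, i.e. $\mathcal H_{i_1\dots i_m}=h_{i_1+\dots+i_m}$ for $0\le i_1,\dots,i_m\le n-1$. Its associated Hankel matrix is the square matrix $H=(h_{i+j})_{i,j=0}^{m(n-1)/2}$. The tensor $\mathcal H$ is called a strong Hankel tensor if $H$ is positive semi-definite. For $\mathbf v\in\mathbb R^n$ let $\mathbf v^{\circ m}$ be the tensor with entries $v_{i_1}v_{i_2}\cdots v_{i_m}$, and let $\mathbf e_n=(0,\dots,0,1)^\top\in\mathbb R^n$. Let $r=\operatorname{rank}(H)$. Then $\mathcal H$ is a strong Hankel tensor if and only if it admits a Vandermonde decomposition with all positive coefficients $$\mathcal H=\sum_{k=1}^{r}\alpha_k\mathbf v_k^{\circ m},\qquad \alpha_k>0,\quad \mathbf v_k=(1,\xi_k,\dots,\xi_k^{n-1})^\top,\quad \xi_k\in\mathbb R,$$ or, with $r\ge 1$, an augmented Vandermonde decomposition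 with all positive coefficients $$\mathcal H=\sum_{k=1}^{r-1}\alpha_k\mathbf v_k^{\circ m}+\alpha_r\mathbf e_n^{\circ m},\qquad \alpha_k>0,\quad \mathbf v_k=(1,\xi_k,\dots,\xi_k^{n-1})^\top,\quad \xi_k\in\mathbb R.$$ (An empty sum is zero.) -/

import Mathlib

/-- Real `m`-th order `n`-dimensional (square) tensors, with 0-based indices. -/
abbrev RealTensor (m n : ℕ) : Type := (Fin m → Fin n) → ℝ

/-- The sum of `m` indices, each in `{0, …, n - 1}`, lies in `{0, …, m (n - 1)}`. -/
theorem index_sum_lt {m n : ℕ} (i : Fin m → Fin n) :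
    ∑ k, (i k : ℕ) < m * (n - 1) + 1 := by
  have h : ∑ k, (i k : ℕ) ≤ ∑ _k : Fin m, (n - 1) :=
    Finset.sum_le_sum fun k _ => by have := (i k).isLt; omega
  simp only [Finset.sum_const, Finset.card_univ, Fintype.card_fin, smul_eq_mul] at h
  omega

/-- The Hankel tensor generated by `h = (h_0, …, h_{m (n - 1)})`: its entry at
`(i_1, …, i_m)` is `h_{i_1 + ⋯ + i_m}`. -/
def hankelTensor (m n : ℕ) (h : Fin (m * (n - 1) + 1) → ℝ) : RealTensor m n :=
  fun i => h ⟨∑ k, (i k : ℕ), index_sum_lt i⟩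

/-- The square Hankel matrix generated by `h = (h_0, …, h_{m (n - 1)})`, of size
`m (n - 1) / 2 + 1`, with entries `h_{i + j}`. This is the associated Hankel matrix of the
Hankel tensor generated by `h`; it is meant for even `m (n - 1)`, which is exactly the case in
which `h` has the right length to generate a square Hankel matrix. -/
def associatedHankelMatrix (m n : ℕ) (h : Fin (m * (n - 1) + 1) → ℝ) :
    Matrix (Fin (m * (n - 1) / 2 + 1)) (Fin (m * (n - 1) / 2 + 1)) ℝ :=
  fun i j => h ⟨(i : ℕ) + (j : ℕ), by have := i.isLt; have := j.isLt; omega⟩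

/-- A strong Hankel tensor: a Hankel tensor whose associated Hankel matrix is positive
semi-definite (used for even `m (n - 1)`). -/
def IsStrongHankelTensor {m n : ℕ} (T : RealTensor m n) : Prop :=
  ∃ h : Fin (m * (n - 1) + 1) → ℝ,
    T = hankelTensor m n h ∧ (associatedHankelMatrix m n h).PosSemidef

/-- The outer product `v_1 ∘ v_2 ∘ ⋯ ∘ v_m`. -/
def outerProduct {m n : ℕ} (v : Fin m → Fin n → ℝ) : RealTensor m n :=
  fun i => ∏ k, v k (i k)

/-- The symmetric rank-one tensor `v^{∘ m} = v ∘ v ∘ ⋯ ∘ v` (`m` times). -/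
def outerPower (m : ℕ) {n : ℕ} (v : Fin n → ℝ) : RealTensor m n :=
  outerProduct fun _ => v

/-- The Vandermonde vector `(1, ξ, ξ ^ 2, …, ξ ^ (n - 1))`. -/
def vandermondeVector (n : ℕ) (ξ : ℝ) : Fin n → ℝ := fun i => ξ ^ (i : ℕ)

/-- The last unit vector `e_n = (0, …, 0, 1)`. -/
def lastUnitVector (n : ℕ) : Fin n → ℝ := fun i => if (i : ℕ) + 1 = n then 1 else 0

/-- `T` has a Vandermonde decomposition `∑_{k = 1}^r α_k v_k^{∘ m}` with all `α_k > 0`. -/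
def HasPositiveVandermondeDecomposition {m n : ℕ} (T : RealTensor m n) (r : ℕ) : Prop :=
  ∃ α ξ : Fin r → ℝ, (∀ k, 0 < α k) ∧
    T = ∑ k, α k • outerPower m (vandermondeVector n (ξ k))

/-- `T` has an augmented Vandermonde decomposition
`∑_{k = 1}^{r - 1} α_k v_k^{∘ m} + α_r e_n^{∘ m}` with all `α_k > 0`; here `r ≥ 1`, `s = r - 1`
and `β = α_r`. -/
def HasPositiveAugmentedVandermondeDecomposition {m n : ℕ} (T : RealTensor m n) (r : ℕ) :
    Prop :=
  ∃ s : ℕ, r = s + 1 ∧ ∃ (α ξ : Fin s → ℝ) (β : ℝ), (∀ k, 0 < α k) ∧ 0 < β ∧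
    T = ∑ k, α k • outerPower m (vandermondeVector n (ξ k)) +
      β • outerPower m (lastUnitVector n)

open scoped InnerProductSpace

/-! Write the positive semidefinite `H` as a Gram matrix, `⟪b i, b j⟫ = h (i + j)` for `i, j ≤ p`.
Let `W` be the span of `b 0, …, b (p - 1)` and `P` the projection onto `W`. The compressed shift `A
(b i) = P (b (i + 1))` is well defined and symmetric because the Gram matrix is Hankel. In an
orthonormal eigenbasis `u k` with eigenvalues `ξ k`, the coordinates of `P (b j)` are `c k * ξ k ^
j`, so Parseval gives atoms `ξ k` with weights `c k ^ 2`. Only the last moment `h (2 * p)` can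
exceed this sum, by the squared distance `β` from `b p` to `W`; this is the `e_n` term. The rank is
`dim W`, plus one if `β ≠ 0`. Conversely, each term of a decomposition contributes a positive
semidefinite rank-one matrix to `H`. -/

/-- A linear map on the span of a finite family can be prescribed on the family as soon as the
prescribed values satisfy all linear relations of the family. -/
theorem exists_linearMap_span_range {ι E F : Type*} [Fintype ι] [AddCommGroup E] [Module ℝ E]
    [AddCommGroup F] [Module ℝ F] (v : ι → E) (w : ι → F)
    (hvw : ∀ c : ι → ℝ, ∑ i, c i • v i = 0 → ∑ i, c i • w i = 0) :
    ∃ A : Submodule.span ℝ (Set.range v) →ₗ[ℝ] F,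
      ∀ i, A ⟨v i, Submodule.subset_span ⟨i, rfl⟩⟩ = w i := by
  classical
  have hmem : ∀ c, Fintype.linearCombination ℝ v c ∈ Submodule.span ℝ (Set.range v) := by
    intro c
    rw [← Fintype.range_linearCombination]
    exact ⟨c, rfl⟩
  let S : (ι → ℝ) →ₗ[ℝ] Submodule.span ℝ (Set.range v) :=
    (Fintype.linearCombination ℝ v).codRestrict _ hmem
  have hS : LinearMap.range S = ⊤ := by
    rw [LinearMap.range_eq_top]
    rintro ⟨x, hx⟩
    rw [← Fintype.range_linearCombination] at hx
    obtain ⟨c, rfl⟩ := hx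
    exact ⟨c, rfl⟩
  obtain ⟨g, hg⟩ := S.exists_rightInverse_of_surjective hS
  refine ⟨Fintype.linearCombination ℝ w ∘ₗ g, fun i => ?_⟩
  set x : Submodule.span ℝ (Set.range v) := ⟨v i, Submodule.subset_span ⟨i, rfl⟩⟩
  have h1 : S (g x) = x := LinearMap.congr_fun hg x
  -- Two coefficient vectors of `v i` differ by a linear relation, on which `w` also vanishes.
  have h2 : Fintype.linearCombination ℝ v (g x - Pi.single i 1) = 0 := by
    have : Fintype.linearCombination ℝ v (g x) = v i := congrArg Subtype.val h1
    rw [map_sub, this]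
    simp [Fintype.linearCombination_apply_single]
  have h3 : Fintype.linearCombination ℝ w (g x - Pi.single i 1) = 0 := hvw _ h2
  rw [map_sub, sub_eq_zero] at h3
  simpa [Fintype.linearCombination_apply_single] using h3

/-- A family of vectors whose Gram matrix is a Hankel matrix: the generating sequence is the moment
sequence of a finitely supported positive measure, up to a nonnegative correction of the last
moment. The number of atoms is the dimension of the span of all vectors but the last. -/
theorem exists_atoms_of_hankel_gram {E : Type*} [NormedAddCommGroup E] [InnerProductSpace ℝ E]
    [FiniteDimensional ℝ E] (p : ℕ) (b : ℕ → E) (h : ℕ → ℝ)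
    (hb : ∀ i j, i ≤ p → j ≤ p → ⟪b i, b j⟫_ℝ = h (i + j)) :
    ∃ (d : ℕ) (α ξ : Fin d → ℝ) (β : ℝ), (∀ k, 0 < α k) ∧ 0 ≤ β ∧
      (∀ j ≤ 2 * p, h j = ∑ k, α k * ξ k ^ j + if j = 2 * p then β else 0) ∧
      Module.finrank ℝ (Submodule.span ℝ (b '' Set.Iic p)) = if β = 0 then d else d + 1 := by
  set v : Fin p → E := fun i => b i with hv
  set W := Submodule.span ℝ (Set.range v) with hW
  have hmem : ∀ i < p, b i ∈ W := fun i hi => Submodule.subset_span ⟨⟨i, hi⟩, rfl⟩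
  set P := W.orthogonalProjectionOnto with hP
  have hPinner : ∀ (x : E) (u : W), ⟪P x, u⟫_ℝ = ⟪x, (u : E)⟫_ℝ := fun x u =>
    W.inner_orthogonalProjectionOnto_eq_of_mem_right u x
  have hPinner' : ∀ (u : W) (x : E), ⟪u, P x⟫_ℝ = ⟪(u : E), x⟫_ℝ := fun u x =>
    W.inner_orthogonalProjectionOnto_eq_of_mem_left u x
  -- vanishing of a vector of `W` is tested on the spanning family
  have hzero : ∀ x : E, (∀ j < p, ⟪x, b j⟫_ℝ = 0) → ∀ u : W, ⟪x, (u : E)⟫_ℝ = 0 := by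
    rintro x hx ⟨u, hu⟩
    change ⟪x, u⟫_ℝ = 0
    induction hu using Submodule.span_induction with
    | mem y hy => obtain ⟨i, rfl⟩ := hy; exact hx i i.2
    | zero => simp
    | add y z _ _ hy hz => rw [inner_add_right, hy, hz, add_zero]
    | smul a y _ hy => rw [inner_smul_right, hy, mul_zero]
  obtain ⟨A, hA⟩ := exists_linearMap_span_range v (fun i => P (b (i + 1))) (by
    intro c hc
    -- The Hankel property moves the shift to the other factor, so the shifted combination is
    -- orthogonal to `W` and its projection vanishes.
    have : ∀ j < p, ⟪∑ i : Fin p, c i • b (i + 1), b j⟫_ℝ = 0 := by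
      intro j hj
      have h1 : ⟪∑ i : Fin p, c i • b i, b (j + 1)⟫_ℝ = 0 := by
        rw [show ∑ i : Fin p, c i • b i = 0 from hc, inner_zero_left]
      rw [← h1, sum_inner, sum_inner]
      refine Finset.sum_congr rfl fun i _ => ?_
      have := i.2
      rw [inner_smul_left, inner_smul_left, hb _ _ (by omega) (by omega),
        hb _ _ (by omega) (by omega), show (i : ℕ) + 1 + j = i + (j + 1) by ring]
    have h2 := hzero _ this
    rw [← inner_self_eq_zero (𝕜 := ℝ)]
    have h3 : ∑ i : Fin p, c i • P (b (i + 1)) = P (∑ i : Fin p, c i • b (i + 1)) := by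
      simp [map_sum]
    rw [h3, hPinner, h2])
  have hAb : ∀ i (hi : i < p), A ⟨b i, hmem i hi⟩ = P (b (i + 1)) := fun i hi => hA ⟨i, hi⟩
  have hsymm : A.IsSymmetric := by
    have key : ∀ i (hi : i < p) (y : W), ⟪A ⟨b i, hmem i hi⟩, y⟫_ℝ = ⟪⟨b i, hmem i hi⟩, A y⟫_ℝ := by
      rintro i hi ⟨y, hy⟩
      induction hy using Submodule.span_induction with
      | mem z hz =>
        obtain ⟨j, rfl⟩ := hz
        have hj := j.2
        rw [hAb i hi, hPinner, hA j, hPinner']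
        change ⟪b (i + 1), b j⟫_ℝ = ⟪b i, b (j + 1)⟫_ℝ
        rw [hb _ _ (by omega) (by omega), hb _ _ (by omega) (by omega),
          show i + 1 + (j : ℕ) = i + (j + 1) by ring]
      | zero =>
        have : (⟨0, Submodule.zero_mem _⟩ : W) = 0 := rfl
        simp [this]
      | add y z hy' hz' hy hz =>
        have : (⟨y + z, Submodule.add_mem _ hy' hz'⟩ : W) = ⟨y, hy'⟩ + ⟨z, hz'⟩ := rfl
        rw [this, map_add, inner_add_right, inner_add_right, hy, hz]
      | smul a y hy' hy =>
        have : (⟨a • y, Submodule.smul_mem _ a hy'⟩ : W) = a • ⟨y, hy'⟩ := rfl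
        rw [this, map_smul, inner_smul_right, inner_smul_right, hy]
    rintro ⟨x, hx⟩ y
    induction hx using Submodule.span_induction with
    | mem z hz => obtain ⟨j, rfl⟩ := hz; exact key j j.2 y
    | zero =>
      have : (⟨0, Submodule.zero_mem _⟩ : W) = 0 := rfl
      simp [this]
    | add x z hx' hz' hx hz =>
      have : (⟨x + z, Submodule.add_mem _ hx' hz'⟩ : W) = ⟨x, hx'⟩ + ⟨z, hz'⟩ := rfl
      rw [this, map_add, inner_add_left, inner_add_left, hx, hz]
    | smul a x hx' hx =>
      have : (⟨a • x, Submodule.smul_mem _ a hx'⟩ : W) = a • ⟨x, hx'⟩ := rfl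
      rw [this, map_smul, inner_smul_left, inner_smul_left, hx]
  set u := hsymm.eigenvectorBasis rfl with hu
  set ξ := hsymm.eigenvalues rfl with hξ
  set c : Fin (Module.finrank ℝ W) → ℝ := fun k => ⟪(u k : E), b 0⟫_ℝ with hc
  have huA : ∀ k, A (u k) = ξ k • u k := fun k => hsymm.apply_eigenvectorBasis rfl k
  have hub : ∀ k j, j ≤ p → ⟪(u k : E), b j⟫_ℝ = c k * ξ k ^ j := by
    intro k j
    induction j with
    | zero => intro _; simp [hc]
    | succ j ih =>
      intro hj
      rw [← hPinner', ← hAb j hj, ← hsymm, huA, real_inner_smul_left, pow_succ]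
      change ξ k * ⟪(u k : E), b j⟫_ℝ = _
      rw [ih (by omega)]
      ring
  -- If `c k = 0`, then `u k ∈ W` is orthogonal to every generator of `W`, hence zero. So all `dim
  -- W` weights are strictly positive.
  have hcne : ∀ k, c k ≠ 0 := by
    intro k hk
    have := hzero (u k) (fun j hj => by rw [hub k j hj.le, hk, zero_mul]) (u k)
    exact u.orthonormal.ne_zero k (inner_self_eq_zero (𝕜 := ℝ).1 this)
  have hPP : ∀ i j, i ≤ p → j ≤ p → ⟪P (b i), P (b j)⟫_ℝ = ∑ k, c k ^ 2 * ξ k ^ (i + j) := by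
    intro i j hi hj
    rw [← u.sum_inner_mul_inner]
    refine Finset.sum_congr rfl fun k _ => ?_
    rw [hPinner, hPinner', real_inner_comm, hub k i hi, hub k j hj]
    ring
  have hPmem : ∀ j < p, (P (b j) : E) = b j := fun j hj =>
    W.starProjection_eq_self_iff.2 (hmem j hj)
  -- Projecting loses nothing as soon as one of the two vectors lies in `W`; only `i = j = p`
  -- escapes.
  have hlow : ∀ i j, i ≤ p → j < p → h (i + j) = ∑ k, c k ^ 2 * ξ k ^ (i + j) := by
    intro i j hi hj
    rw [← hPP i j hi hj.le, hPinner, hPmem j hj, hb i j hi hj.le]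
  have hnorm := W.norm_sq_eq_add_norm_sq_projection (b p)
  set β : ℝ := ‖Wᗮ.orthogonalProjectionOnto (b p)‖ ^ 2 with hβ
  have hβ0 : β = 0 ↔ b p ∈ W := by
    rw [hβ, sq_eq_zero_iff, norm_eq_zero, Submodule.orthogonalProjectionOnto_eq_zero_iff,
      Submodule.orthogonal_orthogonal]
  refine ⟨_, fun k => c k ^ 2, ξ, β, fun k => by have := hcne k; positivity, by positivity, ?_, ?_⟩
  · intro j hj
    split_ifs with hjp
    · subst hjp
      rw [two_mul, ← hPP p p le_rfl le_rfl, ← hb p p le_rfl le_rfl, real_inner_self_eq_norm_sq,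
        real_inner_self_eq_norm_sq, hnorm]
    · rw [add_zero]
      rcases le_total j p with h1 | h1
      · rcases h1.lt_or_eq with h2 | h2
        · simpa using hlow 0 j (Nat.zero_le _) h2
        · simpa using hlow j 0 h1 (by omega)
      · simpa [Nat.add_sub_cancel' h1] using hlow p (j - p) le_rfl (by omega)
  · have himg : b '' Set.Iic p = insert (b p) (Set.range v) := by
      ext x
      simp only [Set.mem_image, Set.mem_Iic, Set.mem_insert_iff, Set.mem_range, hv]
      constructor
      · rintro ⟨i, hi, rfl⟩
        rcases hi.lt_or_eq with h1 | rfl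
        · exact Or.inr ⟨⟨i, h1⟩, rfl⟩
        · exact Or.inl rfl
      · rintro (rfl | ⟨i, rfl⟩)
        · exact ⟨p, le_rfl, rfl⟩
        · exact ⟨i, i.2.le, rfl⟩
    rw [himg]
    split_ifs with h0
    · rw [Submodule.span_insert_eq_span (hβ0.1 h0)]
    · rw [Submodule.span_insert, sup_comm, Submodule.finrank_sup_span_singleton (mt hβ0.2 h0)]

/-- A positive semidefinite Hankel matrix is generated by the moments of a positive measure with
finitely many atoms, up to a nonnegative correction of the last moment; the rank of the matrix
counts the atoms, plus one if the correction is nonzero. -/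
theorem exists_atoms_of_hankel_posSemidef (p : ℕ) (h : ℕ → ℝ)
    (H : Matrix (Fin (p + 1)) (Fin (p + 1)) ℝ) (hH : ∀ i j, H i j = h (i + j))
    (hpos : H.PosSemidef) :
    ∃ (d : ℕ) (α ξ : Fin d → ℝ) (β : ℝ), (∀ k, 0 < α k) ∧ 0 ≤ β ∧
      (∀ j ≤ 2 * p, h j = ∑ k, α k * ξ k ^ j + if j = 2 * p then β else 0) ∧
      H.rank = if β = 0 then d else d + 1 := by
  obtain ⟨N, w, hw⟩ := Matrix.posSemidef_iff_eq_sum_vecMulVec.1 hpos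
  let B : Matrix (Fin N) (Fin (p + 1)) ℝ := Matrix.of fun k i => w k i
  have hB : H = B.transpose * B := by
    rw [hw]
    ext i j
    simp [B, Matrix.sum_apply, Matrix.vecMulVec_apply, Matrix.mul_apply]
  let e : (Fin N → ℝ) ≃ₗ[ℝ] EuclideanSpace ℝ (Fin N) := (WithLp.linearEquiv 2 ℝ _).symm
  let b : ℕ → EuclideanSpace ℝ (Fin N) := fun i => e (B.col (Fin.ofNat (p + 1) i))
  have hof : ∀ i ≤ p, ((Fin.ofNat (p + 1) i : Fin (p + 1)) : ℕ) = i := fun i hi =>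
    Nat.mod_eq_of_lt (by omega)
  obtain ⟨d, α, ξ, β, hα, hβ, hmom, hrank⟩ := exists_atoms_of_hankel_gram p b h (by
    intro i j hi hj
    have h1 := hH (Fin.ofNat (p + 1) i) (Fin.ofNat (p + 1) j)
    rw [hof i hi, hof j hj] at h1
    rw [← h1, hB]
    simp [b, e, Matrix.mul_apply, PiLp.inner_apply, Matrix.col, mul_comm])
  refine ⟨d, α, ξ, β, hα, hβ, hmom, ?_⟩
  rw [← hrank, hB, Matrix.rank_transpose_mul_self, Matrix.rank_eq_finrank_span_cols]
  have himg : b '' Set.Iic p = e '' Set.range B.col := by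
    ext x
    constructor
    · rintro ⟨i, _, rfl⟩
      exact ⟨_, ⟨_, rfl⟩, rfl⟩
    · rintro ⟨_, ⟨i, rfl⟩, rfl⟩
      refine ⟨i, Nat.lt_succ_iff.1 i.2, ?_⟩
      simp [b]
  rw [himg, ← LinearEquiv.coe_coe, Submodule.span_image]
  exact (LinearEquiv.finrank_map_eq e _).symm

theorem exists_index_sum_eq {m n : ℕ} (hn : 1 ≤ n) (s : ℕ) (hs : s ≤ m * (n - 1)) :
    ∃ i : Fin m → Fin n, ∑ k, (i k : ℕ) = s := by
  induction m generalizing s with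
  | zero => exact ⟨Fin.elim0, by simp at hs; simp [hs]⟩
  | succ m ih =>
    rw [Nat.succ_mul] at hs
    -- Greedy choice: the first index takes as much of `s` as it can.
    obtain ⟨i, hi⟩ := ih (s - min s (n - 1)) (by omega)
    refine ⟨Fin.cons ⟨min s (n - 1), by omega⟩ i, ?_⟩
    rw [Fin.sum_univ_succ]
    simp only [Fin.cons_zero, Fin.cons_succ, hi]
    omega

/-- Every generating entry occurs in the tensor, so the generator hidden in `IsStrongHankelTensor`
must be the given `h`, whose matrix has rank `r`. -/
theorem hankelTensor_injective {m n : ℕ} (hn : 1 ≤ n) :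
    Function.Injective (hankelTensor m n) := by
  intro h h' hh
  funext ⟨s, hs⟩
  obtain ⟨i, rfl⟩ := exists_index_sum_eq (m := m) hn s (by omega)
  exact congrFun hh i

theorem outerPower_vandermondeVector_apply {m n : ℕ} (ξ : ℝ) (i : Fin m → Fin n) :
    outerPower m (vandermondeVector n ξ) i = ξ ^ ∑ k, (i k : ℕ) := by
  simp [outerPower, outerProduct, vandermondeVector, Finset.prod_pow_eq_pow_sum]

theorem outerPower_lastUnitVector_apply {m n : ℕ} (i : Fin m → Fin n) :
    outerPower m (lastUnitVector n) i = if ∑ k, (i k : ℕ) = m * (n - 1) then 1 else 0 := by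
  have hle : ∀ k ∈ Finset.univ, (i k : ℕ) ≤ n - 1 := fun k _ => by have := (i k).2; omega
  have hiff : ∑ k, (i k : ℕ) = m * (n - 1) ↔ ∀ k, (i k : ℕ) + 1 = n := by
    have := Finset.sum_eq_sum_iff_of_le hle
    simp only [Finset.sum_const, Finset.card_univ, Fintype.card_fin, smul_eq_mul,
      Finset.mem_univ, true_implies] at this
    rw [this]
    refine forall_congr' fun k => ?_
    have := (i k).2
    omega
  simp only [outerPower, outerProduct, lastUnitVector, Finset.prod_ite_zero,
    Finset.mem_univ, true_implies, Finset.prod_const_one, hiff]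

/-- A nonnegative combination of Vandermonde powers and the last unit power is a strong Hankel
tensor. -/
theorem isStrongHankelTensor_of_decomposition {m n d : ℕ} (heven : Even (m * (n - 1)))
    (α ξ : Fin d → ℝ) (β : ℝ) (hα : ∀ k, 0 ≤ α k) (hβ : 0 ≤ β) :
    IsStrongHankelTensor (∑ k, α k • outerPower m (vandermondeVector n (ξ k)) +
      β • outerPower m (lastUnitVector n)) := by
  refine ⟨fun s => ∑ k, α k * ξ k ^ (s : ℕ) + if (s : ℕ) = m * (n - 1) then β else 0, ?_, ?_⟩
  · funext i
    simp [hankelTensor, outerPower_vandermondeVector_apply, outerPower_lastUnitVector_apply]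
  · set p := m * (n - 1) / 2 with hp
    have h2p : m * (n - 1) = 2 * p := (Nat.two_mul_div_two_of_even heven).symm
    have : associatedHankelMatrix m n
        (fun s => ∑ k, α k * ξ k ^ (s : ℕ) + if (s : ℕ) = m * (n - 1) then β else 0) =
        ∑ k, α k • Matrix.vecMulVec (fun i : Fin (p + 1) => ξ k ^ (i : ℕ))
          (star fun i : Fin (p + 1) => ξ k ^ (i : ℕ)) +
        β • Matrix.vecMulVec (fun i : Fin (p + 1) => if (i : ℕ) = p then (1 : ℝ) else 0)
          (star fun i : Fin (p + 1) => if (i : ℕ) = p then (1 : ℝ) else 0) := by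
      ext i j
      have hi : (i : ℕ) < p + 1 := i.2
      have hj : (j : ℕ) < p + 1 := j.2
      -- The last moment appears only in the bottom right corner of the matrix.
      have hij : (i : ℕ) + j = m * (n - 1) ↔ (j : ℕ) = p ∧ (i : ℕ) = p := by omega
      simp only [associatedHankelMatrix, Matrix.add_apply, Matrix.sum_apply, Matrix.smul_apply,
        Matrix.vecMulVec_apply, star_trivial, smul_eq_mul, pow_add, hij]
      congr 1
      by_cases h1 : (j : ℕ) = p <;> by_cases h2 : (i : ℕ) = p <;> simp [h1, h2]
    rw [this]
    exact (Matrix.posSemidef_sum _ fun k _ =>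
      (Matrix.posSemidef_vecMulVec_self_star _).smul (hα k)).add
        ((Matrix.posSemidef_vecMulVec_self_star _).smul hβ)

theorem mainTheorem2 (m n r : ℕ) (hm : 1 ≤ m) (hn : 1 ≤ n) (heven : Even (m * (n - 1)))
    (h : Fin (m * (n - 1) + 1) → ℝ) (T : RealTensor m n) (hT : T = hankelTensor m n h)
    (hr : (associatedHankelMatrix m n h).rank = r) :
    IsStrongHankelTensor T ↔
      HasPositiveVandermondeDecomposition T r ∨
        HasPositiveAugmentedVandermondeDecomposition T r := by
  constructor
  · rintro ⟨h', hT', hpos⟩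
    obtain rfl : h = h' := hankelTensor_injective hn (hT.symm.trans hT')
    have h2p : 2 * (m * (n - 1) / 2) = m * (n - 1) := Nat.two_mul_div_two_of_even heven
    obtain ⟨d, α, ξ, β, hα, hβ, hmom, hrank⟩ := exists_atoms_of_hankel_posSemidef
      (m * (n - 1) / 2) (fun s => if hs : s < m * (n - 1) + 1 then h ⟨s, hs⟩ else 0)
      (associatedHankelMatrix m n h) (fun i j => by
        have hi := i.2
        have hj := j.2
        rw [dif_pos (by omega)]
        rfl) hpos
    have hTd : T = ∑ k, α k • outerPower m (vandermondeVector n (ξ k)) +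
        β • outerPower m (lastUnitVector n) := by
      funext i
      have hi := index_sum_lt i
      have := hmom (∑ k, (i k : ℕ)) (by omega)
      rw [dif_pos hi, h2p] at this
      rw [hT]
      simp [hankelTensor, outerPower_vandermondeVector_apply, outerPower_lastUnitVector_apply,
        this]
    rw [hr] at hrank
    split_ifs at hrank with h0
    · subst hrank
      exact Or.inl ⟨α, ξ, hα, by rw [hTd, h0, zero_smul, add_zero]⟩
    · exact Or.inr ⟨d, hrank, α, ξ, β, hα, lt_of_le_of_ne hβ (Ne.symm h0), hTd⟩
  · rintro (⟨α, ξ, hα, rfl⟩ | ⟨s, -, α, ξ, β, hα, hβ, rfl⟩)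
    · simpa using isStrongHankelTensor_of_decomposition heven α ξ 0 (fun k => (hα k).le) le_rfl
    · exact isStrongHankelTensor_of_decomposition heven α ξ β (fun k => (hα k).le) hβ.le
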